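/- All structures below are small, with non-empty underlying sets (except that the ample categories may be empty). **Restriction semigroups.** A restriction semigroup is a semigroup $S$ with a unary operation $s\mapsto s^*$ satisfying $xx^*=x$, $x^*y^*=y^*x^*=(x^*y^*)^*$, $(xy)^*=(x^*y)^*$ and $x^*y=y(xy)^*$. Morphisms are maps preserving $\cdot$ and $^*$. Its natural partial order is: $s\le t$ iff $s=ts^*$. **Inductive constellations.** A constellation is a set $Q$ with a partial binary operation $\cdot$ and a unary operation $^*$, with set of projections $P(Q)=\{s^*: s\in Q\}$, such that: (Q1) if $(s\cdot t)\cdot u$ exists then $s\cdot(t\cdot u)$ exists and the two are equal; (Q2) if $s\cdot t$ and $t\cdot u$ exist then so does $(s\cdot t)\cdot u$; (Q3) $s^*$ is the unique $e\in P(Q)$ such that $s\cdot e$ exists and equals $s$; (Q4) if $s^*\cdot t$ exists then $s^*\cdot t=t$. It is an ordered constellation if it carries a partial order $\le$ such that: (O1) if $s\le t$, $u\le v$ and $s\cdot u$, $t\cdot v$ exist, then $s\cdot u\le t\cdot v$; (O2) $s\le t$ implies $s^*\le t^*$; (O3) for $e\in P(Q)$ and $s\in Q$ with $e\le s^*$ there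 is a unique element $s|_e$ with $s|_e\le s$ and $(s|_e)^*=e$; (O4) for $e\in P(Q)$ and $s\in Q$ there is a maximum element ${}_e|s$ among the $t\le s$ such that $e\cdot t$ exists; (O5) if $s\cdot t$ exists and $e\in P(Q)$ then $({}_e|(s\cdot t))^*=({}_{({}_e|s)^*}|t)^*$; (O6) if $e,f\in P(Q)$ and $e|_f$ is defined, then $e|_f={}_f|e$. It is inductive if, moreover, $P(Q)$ is a meet-semilattice under $\le$ with $e\wedge f={}_f|e$. Morphisms of inductive constellations are the ordered radiants, i.e. the maps $\rho\colon Q\to R$ such that: whenever $s\cdot t$ exists, $\rho(s)\cdot\rho(t)$ exists and equals $\rho(s\cdot t)$; $\rho(s^*)=\rho(s)^*$; $s\le t$ implies $\rho(s)\le\rho(t)$; and $\rho({}_e|s)={}_{\rho(e)}|\rho(s)$ for $e\in P(Q)$. For a restriction semigroup $S$, let $\mathbf P(S)$ be the inductive constellation on the set $S$ with the same $^*$, the natural partial order, and the partial product $s\circ t=st$, defined iff $s^*t=t$. On morphisms, $\mathbf P$ does not change the underlying map. **Compact slices.** A topological category is a small category $\mathcal C$ (identified with its set of arrows, objects being identified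 with the set $\mathcal C^{(0)}$ of identity arrows) with a topology for which the domain and range maps $\mathcal C\to\mathcal C^{(0)}$ and the composition are continuous. It is étale if $\mathcal C^{(0)}$ is locally compact and Hausdorff and the domain map is a local homeomorphism. A slice is an open $U\subseteq\mathcal C$ that the domain map sends homeomorphically onto an open subset of $\mathcal C^{(0)}$. An étale category $\mathcal C$ is ample if its compact slices form a basis of the topology. The set $\mathcal C^a$ of compact slices of an ample category is a restriction semigroup under $UV=\{xy: x\in U,\ y\in V,\ xy\text{ defined}\}$ and $U^*=\{\mathrm{dom}(x): x\in U\}$. An inductive constellation of compact slices of an ample category is one of the form $\mathbf P(S)$, where $S$ is a restriction subsemigroup (a non-empty subset closed under the product and $^*$) of $\mathcal C^a$ for some ample category $\mathcal C$. **Theorem.** 1. The category of inductive constellations is equivalent to its full subcategory of inductive constellations of compact slices of ample categories; more precisely, the inclusion functor is an equivalence. 2. The category of restriction semigroups is equivalent to the category of inductive constellations of compact slices of ample categories; more precisely, there is an equivalence whose composite with the inclusion into the category of inductive constellations is naturally isomorphic to $\mathbf P$. -/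

import Mathlib

open CategoryTheory

universe u

namespace SliceESN

/-! ### Restriction semigroups -/

/-- Ehresmann semigroups `(S; ·, *)`; the unary operation `s ↦ s*` is written `dstar`. -/
class EhresmannSemigroup (S : Type u) extends Semigroup S where
  dstar : S → S
  mul_dstar : ∀ x : S, x * dstar x = x
  dstar_comm : ∀ x y : S, dstar x * dstar y = dstar y * dstar x
  dstar_mul_dstar : ∀ x y : S, dstar (dstar x * dstar y) = dstar x * dstar y
  dstar_mul : ∀ x y : S, dstar (x * y) = dstar (dstar x * y)

open EhresmannSemigroup

/-- Restriction semigroups: Ehresmann semigroups satisfying `x* y = y (x y)*`. -/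
class RestrictionSemigroup (S : Type u) extends EhresmannSemigroup S where
  dstar_mul_eq : ∀ x y : S, dstar x * y = y * dstar (x * y)

/-- `(·, *)`-morphisms of restriction semigroups. -/
@[ext]
structure RestrictionHom (S T : Type u) [RestrictionSemigroup S] [RestrictionSemigroup T] where
  toFun : S → T
  map_mul : ∀ x y : S, toFun (x * y) = toFun x * toFun y
  map_dstar : ∀ x : S, toFun (dstar x) = dstar (toFun x)

/-- The category of (non-empty) restriction semigroups: objects. -/
structure RestrSgrp : Type (u + 1) where
  carrier : Type u
  [str : RestrictionSemigroup carrier]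
  [nonempty : Nonempty carrier]

attribute [instance] RestrSgrp.str RestrSgrp.nonempty

instance : Category RestrSgrp.{u} where
  Hom S T := RestrictionHom S.carrier T.carrier
  id S := ⟨id, fun _ _ => rfl, fun _ => rfl⟩
  comp f g := ⟨g.toFun ∘ f.toFun,
    fun x y => by simp [f.map_mul, g.map_mul],
    fun x => by simp [f.map_dstar, g.map_dstar]⟩

/-! ### Inductive constellations -/

/-- A constellation: a set with a partial binary operation (`mul s t h` is the product `s · t`,
defined when `h : Ex s t`) and a unary operation `s ↦ s*`, written `st`. The projections are the
elements `t*`, and `s*` is the unique projection `e` such that `s · e` exists and equals `s`. -/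
class Constellation (Q : Type u) where
  Ex : Q → Q → Prop
  mul : (s t : Q) → Ex s t → Q
  st : Q → Q
  q1 : ∀ (s t u : Q) (h : Ex s t) (h' : Ex (mul s t h) u),
    ∃ (k : Ex t u) (k' : Ex s (mul t u k)), mul s (mul t u k) k' = mul (mul s t h) u h'
  q2 : ∀ (s t u : Q) (h : Ex s t), Ex t u → Ex (mul s t h) u
  q3 : ∀ s : Q, ∃ h : Ex s (st s), mul s (st s) h = s
  q3_unique : ∀ s : Q, ∀ e ∈ Set.range st, (∃ h : Ex s e, mul s e h = s) → e = st s
  q4 : ∀ (s t : Q) (h : Ex (st s) t), mul (st s) t h = t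

namespace Constellation

/-- The set `P(Q)` of projections. -/
def proj (Q : Type u) [Constellation Q] : Set Q := Set.range (st : Q → Q)

/-- `r` is the restriction `s|_e`. -/
def IsRestr {Q : Type u} [Constellation Q] [PartialOrder Q] (s e r : Q) : Prop :=
  r ≤ s ∧ st r = e

/-- `t` is the corestriction `_e|s`: the maximum `t` such that `t ≤ s` and `e · t` exists. -/
def IsCorestr {Q : Type u} [Constellation Q] [PartialOrder Q] (e s t : Q) : Prop :=
  IsGreatest {t : Q | t ≤ s ∧ Ex e t} t

end Constellation

open Constellation

/-- Ordered constellations. -/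
class OrderedConstellation (Q : Type u) extends Constellation Q, PartialOrder Q where
  o1 : ∀ (s t u v : Q) (h : Ex s u) (k : Ex t v), s ≤ t → u ≤ v → mul s u h ≤ mul t v k
  o2 : ∀ s t : Q, s ≤ t → st s ≤ st t
  o3 : ∀ e ∈ proj Q, ∀ s : Q, e ≤ st s → ∃! r : Q, IsRestr s e r
  o4 : ∀ e ∈ proj Q, ∀ s : Q, ∃ t : Q, IsCorestr e s t
  o5 : ∀ (s t : Q) (h : Ex s t), ∀ e ∈ proj Q, ∀ a b c : Q,
    IsCorestr e (mul s t h) a → IsCorestr e s b → IsCorestr (st b) t c → st a = st c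
  o6 : ∀ e ∈ proj Q, ∀ f ∈ proj Q, f ≤ st e → ∀ r c : Q,
    IsRestr e f r → IsCorestr f e c → r = c

/-- Inductive constellations: `P(Q)` is a semilattice whose meets are `e ∧ f = _f|e`. -/
class InductiveConstellation (Q : Type u) extends OrderedConstellation Q where
  ind : ∀ e ∈ proj Q, ∀ f ∈ proj Q, ∀ c : Q, IsCorestr f e c →
    c ∈ proj Q ∧ c ≤ e ∧ c ≤ f ∧ ∀ g ∈ proj Q, g ≤ e → g ≤ f → g ≤ c

/-- Ordered radiants. -/
@[ext]
structure OrderedRadiant (Q R : Type u) [OrderedConstellation Q] [OrderedConstellation R] where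
  toFun : Q → R
  map_mul : ∀ (s t : Q) (h : Ex s t),
    ∃ k : Ex (toFun s) (toFun t), toFun (mul s t h) = mul (toFun s) (toFun t) k
  map_st : ∀ s : Q, toFun (st s) = st (toFun s)
  map_le : ∀ s t : Q, s ≤ t → toFun s ≤ toFun t
  map_corestr : ∀ (s : Q), ∀ e ∈ proj Q, ∀ t : Q,
    IsCorestr e s t → IsCorestr (toFun e) (toFun s) (toFun t)

/-- The category of (non-empty) inductive constellations: objects. -/
structure IndConst : Type (u + 1) where
  carrier : Type u
  [str : InductiveConstellation carrier]
  [nonempty : Nonempty carrier]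

attribute [instance] IndConst.str IndConst.nonempty

theorem OrderedRadiant.map_proj {Q R : Type u} [OrderedConstellation Q] [OrderedConstellation R]
    (f : OrderedRadiant Q R) {e : Q} (he : e ∈ proj Q) : f.toFun e ∈ proj R := by
  obtain ⟨s, rfl⟩ := he
  exact ⟨f.toFun s, (f.map_st s).symm⟩

/-- The category of inductive constellations, with ordered radiants as morphisms. -/
instance : Category IndConst.{u} where
  Hom Q R := OrderedRadiant Q.carrier R.carrier
  id Q := ⟨id, fun _ _ h => ⟨h, rfl⟩, fun _ => rfl, fun _ _ h => h, fun _ _ _ _ h => h⟩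
  comp f g := ⟨g.toFun ∘ f.toFun,
    fun s t h => by
      obtain ⟨k, hk⟩ := f.map_mul s t h
      obtain ⟨l, hl⟩ := g.map_mul _ _ k
      exact ⟨l, by simp [hk, hl]⟩,
    fun s => by simp [f.map_st, g.map_st],
    fun s t h => g.map_le _ _ (f.map_le _ _ h),
    fun s e he t h => g.map_corestr _ _ (f.map_proj he) _ (f.map_corestr _ _ he _ h)⟩

/-! ### The inductive constellation `P(S)` of a restriction semigroup `S` -/

section Assoc

variable {S : Type u} [RestrictionSemigroup S]

theorem dstar_idem (s : S) : dstar s * dstar s = dstar s := by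
  have h1 : dstar (dstar s) = dstar s := by
    have h := dstar_mul s (dstar s)
    rw [mul_dstar, dstar_mul_dstar] at h
    have h2 := mul_dstar (dstar s)
    rw [h, dstar_mul_dstar, ← mul_assoc, ← h] at h2
    rw [← h] at h2
    calc dstar (dstar s) = dstar (dstar s * dstar s) := by rw [← h]
      _ = dstar s * dstar s := dstar_mul_dstar s s
      _ = dstar s := h.symm
  have h2 := mul_dstar (dstar s)
  rwa [h1] at h2

theorem dstar_dstar (s : S) : dstar (dstar s) = dstar s := by
  have h := dstar_mul_dstar s s
  rwa [dstar_idem] at h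

theorem dstar_mul_proj (s t : S) : dstar (s * dstar t) = dstar s * dstar t := by
  rw [dstar_mul, dstar_mul_dstar]

/-- The natural partial order: `s ≤ t` if and only if `s = t s*`. -/
@[reducible] def natOrder (S : Type u) [RestrictionSemigroup S] : PartialOrder S where
  le s t := s = t * dstar s
  le_refl s := (mul_dstar s).symm
  le_trans s t u h k := by
    have h1 : dstar s = dstar t * dstar s := by
      conv_lhs => rw [h, dstar_mul_proj]
    calc s = t * dstar s := h
      _ = (u * dstar t) * dstar s := by rw [← k]
      _ = u * dstar s := by rw [mul_assoc, ← h1]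
  le_antisymm s t h k := by
    have h1 : dstar s = dstar t * dstar s := by
      conv_lhs => rw [h, dstar_mul_proj]
    have k1 : dstar t = dstar s * dstar t := by
      conv_lhs => rw [k, dstar_mul_proj]
    have e : dstar s = dstar t := by rw [h1, dstar_comm, ← k1]
    calc s = t * dstar s := h
      _ = t * dstar t := by rw [e]
      _ = t := mul_dstar t

/-- The constellation of `S`: `s ∘ t` is defined, and equal to `st`, precisely when `s* t = t`. -/
@[reducible] def assocConstellation (S : Type u) [RestrictionSemigroup S] : Constellation S where
  Ex s t := dstar s * t = t
  mul s t _ := s * t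
  st := dstar
  q1 s t u h h' := by
    have e : dstar (s * t) = dstar t := by rw [dstar_mul, h]
    rw [e] at h'
    exact ⟨h', by rw [← mul_assoc, h], (mul_assoc _ _ _).symm⟩
  q2 s t u h k := by rw [dstar_mul, h, k]
  q3 s := ⟨dstar_idem s, mul_dstar s⟩
  q3_unique s e he h := by
    obtain ⟨t, rfl⟩ := he
    obtain ⟨h1, h2⟩ := h
    have := dstar_mul_proj s t
    rw [h2, h1] at this
    exact this.symm
  q4 s t h := by rwa [dstar_dstar] at h

theorem dstar_mul_le (s t : S) : dstar s * t = t * dstar (dstar s * t) := by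
  conv_lhs => rw [← dstar_dstar s, RestrictionSemigroup.dstar_mul_eq]

theorem natOrder_mul_proj_le (s t : S) : (natOrder S).le (s * dstar t) s := by
  change s * dstar t = s * dstar (s * dstar t)
  rw [dstar_mul_proj, ← mul_assoc, mul_dstar]

theorem natOrder_mul {s t u v : S} (h : (natOrder S).le s t) (k : (natOrder S).le u v) :
    (natOrder S).le (s * u) (t * v) := by
  have h' : s = t * dstar s := h
  have k' : u = v * dstar u := k
  change s * u = t * v * dstar (s * u)
  have key : dstar s * u = v * (dstar u * dstar (s * u)) := by
    rw [RestrictionSemigroup.dstar_mul_eq, ← mul_assoc, ← k']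
  have e : dstar u * dstar (s * u) = dstar (s * u) := by
    have h3 : s * u = s * u * dstar u := by rw [mul_assoc, mul_dstar]
    conv_rhs => rw [h3, dstar_mul_proj, dstar_comm]
  calc s * u = t * (dstar s * u) := by rw [← mul_assoc, ← h']
    _ = t * v * dstar (s * u) := by rw [key, e, mul_assoc]

/-- In `P(S)`, the corestriction `_e|s` is `e s`. -/
theorem assoc_isCorestr_iff {e s t : S} (he : dstar e = e) :
    @IsCorestr S (assocConstellation S) (natOrder S) e s t ↔ t = e * s := by
  have hg : @IsCorestr S (assocConstellation S) (natOrder S) e s (e * s) := by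
    refine ⟨⟨?_, ?_⟩, ?_⟩
    · have := dstar_mul_le e s
      rwa [he] at this
    · change dstar e * (e * s) = e * s
      have h := dstar_idem e
      rw [he] at h
      rw [he, ← mul_assoc, h]
    · rintro v ⟨h1, h2⟩
      have h2' : dstar e * v = v := h2
      have h1' : v = s * dstar v := h1
      change v = e * s * dstar v
      rw [mul_assoc, ← h1', ← he, h2']
  constructor
  · intro h
    exact (natOrder S).le_antisymm _ _ (hg.2 h.1) (h.2 hg.1)
  · rintro rfl
    exact hg

/-- The inductive constellation `P(S)` associated to a restriction semigroup `S`: the partial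
product `∘`, the operation `*` and the natural partial order. -/
@[reducible] def assocInductive (S : Type u) [RestrictionSemigroup S] : InductiveConstellation S where
  __ := assocConstellation S
  __ := natOrder S
  o1 s t u v _ _ h k := natOrder_mul h k
  o2 s t h := by
    have h' : s = t * dstar s := h
    change dstar s = dstar t * dstar (dstar s)
    conv_lhs => rw [h', dstar_mul_proj]
    rw [dstar_dstar]
  o3 e he s h := by
    obtain ⟨t, rfl⟩ := he
    have h' : dstar t = dstar s * dstar (dstar t) := h
    rw [dstar_dstar] at h'
    refine ⟨s * dstar t, ⟨natOrder_mul_proj_le s t, ?_⟩, ?_⟩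
    · change dstar (s * dstar t) = dstar t
      rw [dstar_mul_proj, ← h']
    · rintro r ⟨h1, h2⟩
      have h1' : r = s * dstar r := h1
      have h2' : dstar r = dstar t := h2
      rwa [h2'] at h1'
  o4 e he s := by
    obtain ⟨t, rfl⟩ := he
    exact ⟨_, (assoc_isCorestr_iff (dstar_dstar t)).2 rfl⟩
  o5 s t _ e he a b c ha hb hc := by
    obtain ⟨r, rfl⟩ := he
    have ha' := (assoc_isCorestr_iff (dstar_dstar r)).1 ha
    have hb' := (assoc_isCorestr_iff (dstar_dstar r)).1 hb
    have hc' := (assoc_isCorestr_iff (dstar_dstar b)).1 hc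
    change dstar a = dstar c
    have ha2 : a = dstar r * (s * t) := ha'
    have hc2 : c = dstar b * t := hc'
    rw [ha2, hc2, hb', ← mul_assoc]
    exact dstar_mul _ _
  o6 e he f hf _ r c hr hc := by
    obtain ⟨x, rfl⟩ := he
    obtain ⟨y, rfl⟩ := hf
    have hc' := (assoc_isCorestr_iff (dstar_dstar y)).1 hc
    have h1 : r = dstar x * dstar r := hr.1
    have h2 : dstar r = dstar y := hr.2
    rw [h2, dstar_comm] at h1
    exact h1.trans hc'.symm
  ind e he f hf c hc := by
    obtain ⟨x, rfl⟩ := he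
    obtain ⟨y, rfl⟩ := hf
    have hc' : c = dstar y * dstar x := (assoc_isCorestr_iff (dstar_dstar y)).1 hc
    subst hc'
    refine ⟨⟨_, dstar_mul_dstar y x⟩, ?_, natOrder_mul_proj_le _ _, ?_⟩
    · rw [dstar_comm]
      exact natOrder_mul_proj_le _ _
    · rintro g ⟨z, rfl⟩ h1 h2
      have h1' : dstar z = dstar x * dstar (dstar z) := h1
      have h2' : dstar z = dstar y * dstar (dstar z) := h2
      rw [dstar_dstar] at h1' h2'
      change dstar z = dstar y * dstar x * dstar (dstar z)
      rw [dstar_dstar, mul_assoc, ← h1', ← h2']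

end Assoc

/-- The functor `P` from restriction semigroups to inductive constellations; it does not change
the underlying sets and maps. -/
def assocFunctor : RestrSgrp.{u} ⥤ IndConst.{u} where
  obj S := @IndConst.mk S.carrier (assocInductive S.carrier) S.nonempty
  map {S T} f := @OrderedRadiant.mk S.carrier T.carrier
    (assocInductive S.carrier).toOrderedConstellation
    (assocInductive T.carrier).toOrderedConstellation
    f.toFun
    (fun s t h => by
      refine ⟨?_, f.map_mul s t⟩
      have h' : dstar s * t = t := h
      change dstar (f.toFun s) * f.toFun t = f.toFun t
      rw [← f.map_dstar, ← f.map_mul, h'])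
    f.map_dstar
    (fun s t h => by
      have h' : s = t * dstar s := h
      change f.toFun s = f.toFun t * dstar (f.toFun s)
      rw [← f.map_dstar, ← f.map_mul, ← h'])
    (fun s e he t h => by
      obtain ⟨x, rfl⟩ := he
      have h' : t = dstar x * s := (assoc_isCorestr_iff (dstar_dstar x)).1 h
      have hx : dstar (f.toFun (dstar x)) = f.toFun (dstar x) := by
        rw [← f.map_dstar, dstar_dstar]
      refine (assoc_isCorestr_iff hx).2 ?_
      rw [h', f.map_mul])

/-! ### Ample categories and compact slices -/

/-- A small category, given by its set of arrows; the units (identity arrows) stand for the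
objects. The product `xy` is defined when `ran y = dom x`. -/
class ArrowCategory (C : Type u) where
  dom : C → C
  ran : C → C
  range_dom : Set.range dom = Set.range ran
  comp : (x y : C) → ran y = dom x → C
  dom_unit : ∀ x ∈ Set.range dom, dom x = x
  ran_unit : ∀ x ∈ Set.range dom, ran x = x
  dom_comp : ∀ (x y : C) (h : ran y = dom x), dom (comp x y h) = dom y
  ran_comp : ∀ (x y : C) (h : ran y = dom x), ran (comp x y h) = ran x
  assoc : ∀ (x y z : C) (h : ran y = dom x) (k : ran z = dom y),
    comp (comp x y h) z (k.trans (dom_comp x y h).symm) =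
      comp x (comp y z k) ((ran_comp y z k).trans h)
  ran_comp_self : ∀ (x : C) (h : ran x = dom (ran x)), comp (ran x) x h = x
  comp_dom_self : ∀ (x : C) (h : ran (dom x) = dom x), comp x (dom x) h = x

namespace ArrowCategory

/-- The set of units. -/
def units (C : Type u) [ArrowCategory C] : Set C := Set.range (dom : C → C)

/-- The domain map, as a map to the set of units. -/
def domU {C : Type u} [ArrowCategory C] (x : C) : units C := ⟨dom x, x, rfl⟩

/-- The range map, as a map to the set of units. -/
def ranU {C : Type u} [ArrowCategory C] (x : C) : units C :=
  ⟨ran x, by rw [units, range_dom]; exact ⟨x, rfl⟩⟩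

/-- The set of composable pairs. -/
def pairs (C : Type u) [ArrowCategory C] : Set (C × C) := {p | ran p.2 = dom p.1}

end ArrowCategory

open ArrowCategory

/-- Topological categories. -/
class IsTopologicalCategory (C : Type u) [ArrowCategory C] [TopologicalSpace C] : Prop where
  continuous_dom : Continuous (domU : C → units C)
  continuous_ran : Continuous (ranU : C → units C)
  continuous_comp : Continuous fun p : pairs C => comp p.1.1 p.1.2 p.2

/-- Étale categories. -/
class IsEtale (C : Type u) [ArrowCategory C] [TopologicalSpace C] : Prop
    extends IsTopologicalCategory C where
  locallyCompact : LocallyCompactSpace (units C)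
  hausdorff : T2Space (units C)
  isLocalHomeomorph_dom : IsLocalHomeomorph (domU : C → units C)

/-- Slices: open sets on which `dom` is a homeomorphism onto an open set of units. -/
def IsSlice {C : Type u} [ArrowCategory C] [TopologicalSpace C] (U : Set C) : Prop :=
  IsOpen U ∧ Topology.IsOpenEmbedding (U.domRestrict (domU : C → units C))

/-- The set `C^a` of compact slices. -/
def compactSlices (C : Type u) [ArrowCategory C] [TopologicalSpace C] : Set (Set C) :=
  {U | IsSlice U ∧ IsCompact U}

/-- Ample categories: étale categories in which the compact slices form a basis. -/
class IsAmple (C : Type u) [ArrowCategory C] [TopologicalSpace C] : Prop extends IsEtale C where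
  isBasis : TopologicalSpace.IsTopologicalBasis (compactSlices C)

/-- The product of subsets of a category. -/
def setMul {C : Type u} [ArrowCategory C] (U V : Set C) : Set C :=
  {z | ∃ x ∈ U, ∃ y ∈ V, ∃ h : ran y = dom x, z = comp x y h}

/-- The operation `U ↦ U* = dom U` on subsets of a category. -/
def setStar {C : Type u} [ArrowCategory C] (U : Set C) : Set C := dom '' U

/-- Restriction subsemigroups of `C^a`: non-empty sets of compact slices that are closed under
the product of subsets and under `U ↦ U*`. -/
structure SliceSubsemigroup (C : Type u) [ArrowCategory C] [TopologicalSpace C] where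
  carrier : Set (Set C)
  subset_compactSlices : carrier ⊆ compactSlices C
  nonempty : carrier.Nonempty
  mul_mem : ∀ U ∈ carrier, ∀ V ∈ carrier, setMul U V ∈ carrier
  star_mem : ∀ U ∈ carrier, setStar U ∈ carrier

section SetLemmas

variable {C : Type u} [ArrowCategory C]

theorem dom_dom (x : C) : dom (dom x) = dom x := dom_unit _ ⟨x, rfl⟩

theorem ran_dom (x : C) : ran (dom x) = dom x := ran_unit _ ⟨x, rfl⟩

theorem dom_ran (x : C) : dom (ran x) = ran x :=
  dom_unit _ (by rw [range_dom]; exact ⟨x, rfl⟩)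

theorem comp_dom_eq {x u : C} (h : ran u = dom x) (hu : dom u = u) : comp x u h = x := by
  have : u = dom x := by rw [← h, ← hu, ran_dom]
  subst this
  exact comp_dom_self x h

theorem dom_comp_eq {x u : C} (h : ran x = dom u) (hu : dom u = u) : comp u x h = x := by
  have : u = ran x := by rw [h, hu]
  subst this
  exact ran_comp_self x h

theorem mem_setMul_star {U V : Set C} {z : C} :
    z ∈ setMul U (setStar V) ↔ z ∈ U ∧ dom z ∈ setStar V := by
  constructor
  · rintro ⟨x, hx, y, ⟨v, hv, rfl⟩, h, rfl⟩
    have hh : dom v = dom x := by rw [← h, ran_dom]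
    rw [comp_dom_eq h (dom_dom v)]
    exact ⟨hx, v, hv, hh⟩
  · rintro ⟨hz, hd⟩
    exact ⟨z, hz, dom z, hd, ran_dom z, (comp_dom_self z _).symm⟩

theorem mem_setStar_mul {U V : Set C} {z : C} :
    z ∈ setMul (setStar U) V ↔ z ∈ V ∧ ran z ∈ setStar U := by
  constructor
  · rintro ⟨x, ⟨v, hv, rfl⟩, y, hy, h, rfl⟩
    rw [dom_comp_eq h (dom_dom v)]
    exact ⟨hy, v, hv, by rw [h, dom_dom]⟩
  · rintro ⟨hz, hd⟩
    exact ⟨ran z, hd, z, hz, (dom_ran z).symm, (ran_comp_self z _).symm⟩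

theorem mem_setStar_setMul {U V : Set C} {w : C} :
    w ∈ setStar (setMul U V) ↔ ∃ y ∈ V, ran y ∈ setStar U ∧ dom y = w := by
  constructor
  · rintro ⟨_, ⟨x, hx, y, hy, h, rfl⟩, rfl⟩
    exact ⟨y, hy, ⟨x, hx, h.symm⟩, (dom_comp x y h).symm⟩
  · rintro ⟨y, hy, ⟨x, hx, h⟩, rfl⟩
    exact ⟨_, ⟨x, hx, y, hy, h.symm, rfl⟩, dom_comp x y h.symm⟩

theorem setStar_setStar (U : Set C) : setStar (setStar U) = setStar U := by
  ext w
  constructor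
  · rintro ⟨_, ⟨x, hx, rfl⟩, rfl⟩
    exact ⟨x, hx, (dom_dom x).symm⟩
  · rintro ⟨x, hx, rfl⟩
    exact ⟨dom x, ⟨x, hx, rfl⟩, dom_dom x⟩

theorem setStar_mul_setStar (U V : Set C) :
    setMul (setStar U) (setStar V) = setStar U ∩ setStar V := by
  ext w
  rw [mem_setMul_star]
  constructor
  · rintro ⟨⟨x, hx, rfl⟩, h⟩
    rw [dom_dom] at h
    exact ⟨⟨x, hx, rfl⟩, h⟩
  · rintro ⟨⟨x, hx, rfl⟩, h⟩
    exact ⟨⟨x, hx, rfl⟩, by rwa [dom_dom]⟩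

theorem setMul_assoc (U V W : Set C) : setMul (setMul U V) W = setMul U (setMul V W) := by
  ext w
  constructor
  · rintro ⟨_, ⟨x, hx, y, hy, h, rfl⟩, z, hz, k, rfl⟩
    have k' : ran z = dom y := by rw [k, dom_comp]
    exact ⟨x, hx, _, ⟨y, hy, z, hz, k', rfl⟩, (ran_comp y z k').trans h, assoc x y z h k'⟩
  · rintro ⟨x, hx, _, ⟨y, hy, z, hz, k, rfl⟩, h, rfl⟩
    have h' : ran y = dom x := by rw [← h, ran_comp]
    exact ⟨_, ⟨x, hx, y, hy, h', rfl⟩, z, hz, k.trans (dom_comp x y h').symm,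
      (assoc x y z h' k).symm⟩

theorem IsSlice.dom_injOn [TopologicalSpace C] {U : Set C} (hU : IsSlice U) {x y : C}
    (hx : x ∈ U) (hy : y ∈ U) (h : dom x = dom y) : x = y := by
  have := @hU.2.injective ⟨x, hx⟩ ⟨y, hy⟩ (Subtype.ext h)
  exact congrArg Subtype.val this

end SetLemmas

/-- The restriction semigroup structure of a restriction subsemigroup of `C^a`. -/
instance SliceSubsemigroup.restrictionSemigroup {C : Type u} [ArrowCategory C]
    [TopologicalSpace C] (S : SliceSubsemigroup C) : RestrictionSemigroup S.carrier where
  mul U V := ⟨setMul U.1 V.1, S.mul_mem _ U.2 _ V.2⟩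
  mul_assoc U V W := Subtype.ext (setMul_assoc _ _ _)
  dstar U := ⟨setStar U.1, S.star_mem _ U.2⟩
  mul_dstar U := Subtype.ext <| Set.ext fun z => by
    change z ∈ setMul U.1 (setStar U.1) ↔ z ∈ U.1
    rw [mem_setMul_star]
    exact ⟨fun h => h.1, fun h => ⟨h, z, h, rfl⟩⟩
  dstar_comm U V := Subtype.ext <| by
    change setMul (setStar U.1) (setStar V.1) = setMul (setStar V.1) (setStar U.1)
    rw [setStar_mul_setStar, setStar_mul_setStar, Set.inter_comm]
  dstar_mul_dstar U V := Subtype.ext <| Set.ext fun w => by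
    change w ∈ setStar (setMul (setStar U.1) (setStar V.1)) ↔
      w ∈ setMul (setStar U.1) (setStar V.1)
    rw [setStar_mul_setStar]
    constructor
    · rintro ⟨_, ⟨⟨x, hx, rfl⟩, h⟩, rfl⟩
      rw [dom_dom]
      exact ⟨⟨x, hx, rfl⟩, h⟩
    · rintro ⟨⟨x, hx, rfl⟩, h⟩
      exact ⟨dom x, ⟨⟨x, hx, rfl⟩, h⟩, dom_dom x⟩
  dstar_mul U V := Subtype.ext <| Set.ext fun w => by
    change w ∈ setStar (setMul U.1 V.1) ↔ w ∈ setStar (setMul (setStar U.1) V.1)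
    rw [mem_setStar_setMul, mem_setStar_setMul, setStar_setStar]
  dstar_mul_eq U V := Subtype.ext <| Set.ext fun z => by
    change z ∈ setMul (setStar U.1) V.1 ↔ z ∈ setMul V.1 (setStar (setMul U.1 V.1))
    rw [mem_setStar_mul, mem_setMul_star, mem_setStar_setMul]
    constructor
    · rintro ⟨h1, h2⟩
      exact ⟨h1, z, h1, h2, rfl⟩
    · rintro ⟨h1, y, hy, h2, h3⟩
      have : y = z := (S.subset_compactSlices V.2).1.dom_injOn hy h1 h3
      subst this
      exact ⟨h1, h2⟩

/-- A restriction subsemigroup of `C^a`, as a restriction semigroup. -/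
def SliceSubsemigroup.toRestrSgrp {C : Type u} [ArrowCategory C] [TopologicalSpace C]
    (S : SliceSubsemigroup C) : RestrSgrp.{u} :=
  @RestrSgrp.mk S.carrier S.restrictionSemigroup S.nonempty.to_subtype

/-- The inductive constellations of compact slices of ample categories: the inductive
constellations `P(S)`, where `S` is a restriction subsemigroup of `C^a` for an ample
category `C`. -/
def isSliceConstellation : ObjectProperty IndConst.{u} := fun Q =>
  ∃ (C : Type u) (_ : ArrowCategory C) (_ : TopologicalSpace C) (_ : IsAmple C)
    (S : SliceSubsemigroup C), Q = assocFunctor.obj S.toRestrSgrp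

end SliceESN

namespace SliceESN

open EhresmannSemigroup Constellation

/-! ### The restriction semigroup of an inductive constellation -/

section Constellation

variable {Q : Type u} [Constellation Q]

/-! Two facts carry the theorem: `assocFunctor` is an equivalence, and every restriction semigroup
embeds in the compact slices of an ample category.

For the first, an inductive constellation is made into a semigroup by the pseudoproduct s ⊗ t = s ·
(_{s*}|t). It is associative because _{s*}|(t ⊗ u) = (_{s*}|t) ⊗ u (`corestr_pseudoMul`): both sides
lie below t ⊗ u, (O5) gives them the same star, and (O3) lets the star determine an element below a
given one. The constellation of this semigroup is the original one up to the identity map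
(`assocFunctorObjIso`), which gives essential surjectivity. Fullness holds since st = s ∘ (s*t) and
s*t is a corestriction, so ordered radiants preserve all products.

For the second, adjoin an identity to S and let the monoid act partially on the compact, totally
disconnected space of characters of its projections, by (sχ)(a) = χ(as). The germs of this action
form an ample category, and s ↦ {germs of s} preserves products and stars. It is injective because
the germ at the principal character of s* detects s (`eq_mul_of_slice_subset`). Hence every
inductive constellation is isomorphic to one of compact slices, so the fully faithful inclusion is
essentially surjective; composing `assocFunctor` with its quasi-inverse gives the second
equivalence. -/

theorem st_mem_proj (s : Q) : st s ∈ proj Q := ⟨s, rfl⟩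

theorem ex_st_st (s : Q) : Ex (st s) (st s) := by
  obtain ⟨h, e⟩ := q3 s
  have h' : Ex (mul s (st s) h) (st s) := by rwa [e]
  exact (q1 _ _ _ h h').1

theorem st_st (s : Q) : st (st s) = st s :=
  (q3_unique (st s) (st s) ⟨s, rfl⟩ ⟨ex_st_st s, q4 _ _ _⟩).symm

theorem st_of_mem_proj {e : Q} (he : e ∈ proj Q) : st e = e := by
  obtain ⟨s, rfl⟩ := he
  exact st_st s

/-- Rebracketing s = s · s* by (Q1) and (Q2) shows that left composability depends only on the star.
-/
theorem ex_st_iff {s t : Q} : Ex (st s) t ↔ Ex s t := by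
  obtain ⟨h, e⟩ := q3 s
  constructor
  · intro k
    have := q2 _ _ _ h k
    rwa [e] at this
  · intro k
    have h' : Ex (mul s (st s) h) t := by rwa [e]
    exact (q1 _ _ _ h h').1

theorem ex_mul {s t u : Q} (h : Ex s t) (k : Ex t u) :
    ∃ l : Ex s (mul t u k), mul s (mul t u k) l = mul (mul s t h) u (q2 _ _ _ h k) :=
  (q1 _ _ _ h (q2 _ _ _ h k)).2

/-- The projection t* is a right unit for s · t, since (s · t) · t* = s · (t · t*); (Q3) allows only
one. -/
theorem st_mul {s t : Q} (h : Ex s t) : st (mul s t h) = st t := by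
  obtain ⟨k, e⟩ := q3 t
  obtain ⟨l, hl⟩ := ex_mul h k
  refine (q3_unique _ _ ⟨t, rfl⟩ ⟨q2 _ _ _ h k, ?_⟩).symm
  rw [← hl]
  congr 1

end Constellation

/-! ### Ordered constellations: corestrictions and the pseudoproduct. -/

section Ordered

variable {Q : Type u} [OrderedConstellation Q]

/-- The corestriction `_{s*}|t`. -/
noncomputable def corestr (s t : Q) : Q :=
  (OrderedConstellation.o4 (st s) (st_mem_proj s) t).choose

theorem isCorestr_corestr (s t : Q) : IsCorestr (st s) t (corestr s t) :=
  (OrderedConstellation.o4 (st s) (st_mem_proj s) t).choose_spec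

theorem corestr_le (s t : Q) : corestr s t ≤ t := (isCorestr_corestr s t).1.1

theorem ex_corestr (s t : Q) : Ex s (corestr s t) := ex_st_iff.1 (isCorestr_corestr s t).1.2

theorem le_corestr {s t r : Q} (h : r ≤ t) (k : Ex s r) : r ≤ corestr s t :=
  (isCorestr_corestr s t).2 ⟨h, ex_st_iff.2 k⟩

theorem corestr_eq_self_iff {s t : Q} : corestr s t = t ↔ Ex s t := by
  constructor
  · intro h
    rw [← h]
    exact ex_corestr s t
  · intro h
    exact le_antisymm (corestr_le s t) (le_corestr le_rfl h)

theorem corestr_st_left (s t : Q) : corestr (st s) t = corestr s t :=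
  le_antisymm (le_corestr (corestr_le _ _) (ex_st_iff.1 (ex_corestr _ _)))
    (le_corestr (corestr_le _ _) (ex_st_iff.2 (ex_corestr _ _)))

/-- The pseudoproduct of an ordered constellation. -/
noncomputable def pseudoMul (s t : Q) : Q := mul s (corestr s t) (ex_corestr s t)

theorem st_pseudoMul (s t : Q) : st (pseudoMul s t) = st (corestr s t) := st_mul _

theorem pseudoMul_of_ex {s t : Q} (h : Ex s t) : pseudoMul s t = mul s t h := by
  unfold pseudoMul
  congr 1
  exact corestr_eq_self_iff.2 h

theorem pseudoMul_st_left (s t : Q) : pseudoMul (st s) t = corestr s t := by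
  rw [pseudoMul, q4, corestr_st_left]

theorem pseudoMul_st_self (s : Q) : pseudoMul s (st s) = s := by
  obtain ⟨h, e⟩ := q3 s
  rw [pseudoMul_of_ex h, e]

/-- Both elements are the restriction of s to the same projection, and (O3) makes it unique. This is
the main tool for proving equalities below. -/
theorem eq_of_le_of_st_eq {a b s : Q} (ha : a ≤ s) (hb : b ≤ s) (h : st a = st b) : a = b :=
  (OrderedConstellation.o3 (st b) (st_mem_proj b) s (OrderedConstellation.o2 _ _ hb)).unique
    ⟨ha, h⟩ ⟨hb, rfl⟩

end Ordered

/-! ### Inductive constellations: the pseudoproduct is a restriction semigroup. -/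

section Inductive

variable {Q : Type u} [InductiveConstellation Q]

theorem corestr_st_spec (s t : Q) : corestr s (st t) ∈ proj Q ∧ corestr s (st t) ≤ st t ∧
    corestr s (st t) ≤ st s ∧ ∀ g ∈ proj Q, g ≤ st t → g ≤ st s → g ≤ corestr s (st t) :=
  InductiveConstellation.ind (st t) (st_mem_proj t) (st s) (st_mem_proj s) _
    (isCorestr_corestr s (st t))

/-- Both sides are the meet of s* and t* in the semilattice of projections. -/
theorem corestr_st_comm (s t : Q) : corestr s (st t) = corestr t (st s) := by
  obtain ⟨a1, a2, a3, a4⟩ := corestr_st_spec s t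
  obtain ⟨b1, b2, b3, b4⟩ := corestr_st_spec t s
  exact le_antisymm (b4 _ a1 a3 a2) (a4 _ b1 b3 b2)

theorem ex_st_of_le {s t : Q} (h : st s ≤ st t) : Ex t (st s) := by
  obtain ⟨_, h2, _, h4⟩ := corestr_st_spec t s
  rw [← corestr_eq_self_iff]
  exact le_antisymm h2 (h4 _ (st_mem_proj s) le_rfl h)

/-- Insert s* in between: t · s* and s* · u exist, hence so does t · (s* · u), and s* · u = u. -/
theorem ex_of_st_le {s t u : Q} (h : st s ≤ st t) (k : Ex s u) : Ex t u := by
  have h1 := ex_st_of_le h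
  have k1 : Ex (st s) u := ex_st_iff.2 k
  obtain ⟨l, -⟩ := ex_mul h1 k1
  rwa [q4] at l

theorem pseudoMul_proj_le (s t : Q) : pseudoMul s (st t) ≤ s := by
  obtain ⟨h, e⟩ := q3 s
  conv_rhs => rw [← e]
  exact OrderedConstellation.o1 _ _ _ _ _ _ le_rfl (corestr_st_spec s t).2.2.1

/-- Both sides lie below t and have star s*. This identifies the given order with the natural order
of the semigroup, and also yields the restriction identity x*y = y(xy)*. -/
theorem pseudoMul_st_of_le {s t : Q} (h : s ≤ t) : pseudoMul t (st s) = s := by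
  have h1 := OrderedConstellation.o2 _ _ h
  refine eq_of_le_of_st_eq (pseudoMul_proj_le t s) h ?_
  rw [pseudoMul_of_ex (ex_st_of_le h1), st_mul, st_st]

theorem le_iff_eq_pseudoMul {s t : Q} : s ≤ t ↔ s = pseudoMul t (st s) := by
  constructor
  · exact fun h => (pseudoMul_st_of_le h).symm
  · intro h
    rw [h]
    exact pseudoMul_proj_le t s

/-- Both sides lie below t ⊗ u, so it suffices to compare stars, which is what (O5) does for the
existing product t · (_{t*}|u). -/
theorem corestr_pseudoMul (s t u : Q) :
    corestr s (pseudoMul t u) = pseudoMul (corestr s t) u := by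
  have ha : st (corestr s t) ≤ st t := OrderedConstellation.o2 _ _ (corestr_le s t)
  have hw : corestr (corestr s t) u ≤ corestr t u :=
    le_corestr (corestr_le _ _) (ex_of_st_le ha (ex_corestr _ _))
  have hle : pseudoMul (corestr s t) u ≤ pseudoMul t u :=
    OrderedConstellation.o1 _ _ _ _ _ _ (corestr_le s t) hw
  -- (O5) produces the iterated corestriction of u; the inner one is redundant because (_{s*}|t)* ≤
  -- t*.
  have hb : corestr (corestr s t) (corestr t u) = corestr (corestr s t) u :=
    le_antisymm (le_corestr ((corestr_le _ _).trans (corestr_le _ _)) (ex_corestr _ _))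
      (le_corestr hw (ex_corestr _ _))
  refine eq_of_le_of_st_eq (corestr_le _ _) hle ?_
  rw [st_pseudoMul, ← hb]
  exact OrderedConstellation.o5 t (corestr t u) (ex_corestr t u) (st s) (st_mem_proj s) _ _ _
    (isCorestr_corestr _ _) (isCorestr_corestr _ _) (isCorestr_corestr _ _)

/-- As s ⊗ t and a = _{s*}|t have the same star, both bracketings equal the existing triple product
s · a · (_{a*}|u). -/
theorem pseudoMul_assoc (s t u : Q) :
    pseudoMul (pseudoMul s t) u = pseudoMul s (pseudoMul t u) := by
  obtain ⟨l, hl⟩ := ex_mul (ex_corestr s t) (ex_corestr (corestr s t) u)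
  have e1 : corestr (pseudoMul s t) u = corestr (corestr s t) u := by
    rw [← corestr_st_left (pseudoMul s t), st_pseudoMul, corestr_st_left]
  have e2 : corestr s (pseudoMul t u) = mul (corestr s t) _ (ex_corestr (corestr s t) u) :=
    corestr_pseudoMul s t u
  calc pseudoMul (pseudoMul s t) u
      = mul (mul s _ (ex_corestr s t)) _ (q2 _ _ _ _ (ex_corestr (corestr s t) u)) := by
        unfold pseudoMul at e1 ⊢
        congr 1
    _ = _ := hl.symm
    _ = pseudoMul s (pseudoMul t u) := by
        conv_rhs => rw [pseudoMul]
        congr 1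
        exact e2.symm

variable (Q) in
/-- The restriction semigroup of an inductive constellation: the pseudoproduct. -/
@[reducible] noncomputable def pseudoRestriction : RestrictionSemigroup Q where
  mul := pseudoMul
  mul_assoc := pseudoMul_assoc
  dstar := st
  mul_dstar := pseudoMul_st_self
  dstar_comm x y := by
    change pseudoMul (st x) (st y) = pseudoMul (st y) (st x)
    rw [pseudoMul_st_left, pseudoMul_st_left, corestr_st_comm]
  dstar_mul_dstar x y := by
    change st (pseudoMul (st x) (st y)) = pseudoMul (st x) (st y)
    rw [pseudoMul_st_left]
    exact st_of_mem_proj (corestr_st_spec x y).1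
  dstar_mul x y := by
    change st (pseudoMul x y) = st (pseudoMul (st x) y)
    rw [st_pseudoMul, pseudoMul_st_left]
  dstar_mul_eq x y := by
    change pseudoMul (st x) y = pseudoMul y (st (pseudoMul x y))
    rw [pseudoMul_st_left, st_pseudoMul, pseudoMul_st_of_le (corestr_le x y)]

end Inductive

/-- The restriction semigroup of an object of the category of inductive constellations. -/
noncomputable def IndConst.toRestrSgrp (Q : IndConst.{u}) : RestrSgrp.{u} :=
  @RestrSgrp.mk Q.carrier (pseudoRestriction Q.carrier) Q.nonempty

/-! ### The functor from restriction semigroups to inductive constellations is an equivalence. -/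

theorem isCorestr_map {Q R : Type u} [OrderedConstellation Q] [OrderedConstellation R]
    (f : Q ≃ R) (hle : ∀ s t, s ≤ t ↔ f s ≤ f t) (hex : ∀ s t, Ex s t ↔ Ex (f s) (f t))
    {e s t : Q} (h : IsCorestr e s t) : IsCorestr (f e) (f s) (f t) := by
  refine ⟨⟨(hle _ _).1 h.1.1, (hex _ _).1 h.1.2⟩, fun r hr => ?_⟩
  obtain ⟨r, rfl⟩ := f.surjective r
  exact (hle _ _).1 (h.2 ⟨(hle _ _).2 hr.1, (hex _ _).2 hr.2⟩)

/-- The pseudoproduct s* ⊗ t is the corestriction _{s*}|t, which is all of t exactly when s · t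
exists. -/
theorem ex_assoc_iff {Q : Type u} [InductiveConstellation Q] (s t : Q) :
    (@assocConstellation Q (pseudoRestriction Q)).Ex s t ↔ Ex s t := by
  change pseudoMul (st s) t = t ↔ _
  rw [pseudoMul_st_left, corestr_eq_self_iff]

/-- An inductive constellation is isomorphic to the one associated to its restriction
semigroup. -/
noncomputable def assocFunctorObjIso (Q : IndConst.{u}) :
    assocFunctor.obj Q.toRestrSgrp ≅ Q where
  hom := @OrderedRadiant.mk Q.carrier Q.carrier
    (@assocInductive Q.carrier (pseudoRestriction Q.carrier)).toOrderedConstellation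
    Q.str.toOrderedConstellation id
    (fun s t h => ⟨(ex_assoc_iff s t).1 h, pseudoMul_of_ex ((ex_assoc_iff s t).1 h)⟩)
    (fun _ => rfl) (fun _ _ h => le_iff_eq_pseudoMul.2 h)
    (fun _ _ _ _ h => @isCorestr_map _ _
      (@assocInductive Q.carrier (pseudoRestriction Q.carrier)).toOrderedConstellation
      Q.str.toOrderedConstellation (Equiv.refl _) (fun _ _ => le_iff_eq_pseudoMul.symm)
      ex_assoc_iff _ _ _ h)
  inv := @OrderedRadiant.mk Q.carrier Q.carrier Q.str.toOrderedConstellation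
    (@assocInductive Q.carrier (pseudoRestriction Q.carrier)).toOrderedConstellation id
    (fun s t h => ⟨(ex_assoc_iff s t).2 h, (pseudoMul_of_ex h).symm⟩)
    (fun _ => rfl) (fun _ _ h => le_iff_eq_pseudoMul.1 h)
    (fun _ _ _ _ h => @isCorestr_map _ _ Q.str.toOrderedConstellation
      (@assocInductive Q.carrier (pseudoRestriction Q.carrier)).toOrderedConstellation
      (Equiv.refl _) (fun _ _ => le_iff_eq_pseudoMul)
      (fun s t => (ex_assoc_iff s t).symm) _ _ _ h)
  hom_inv_id := rfl
  inv_hom_id := rfl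

instance : assocFunctor.{u}.EssSurj where
  mem_essImage Q := ⟨Q.toRestrSgrp, ⟨assocFunctorObjIso Q⟩⟩

instance : assocFunctor.{u}.Faithful where
  map_injective {S T f g} h := by
    have h1 : f.toFun = g.toFun := congrArg
      (@OrderedRadiant.toFun _ _ (assocInductive S.carrier).toOrderedConstellation
        (assocInductive T.carrier).toOrderedConstellation) h
    exact RestrictionHom.ext h1

instance : assocFunctor.{u}.Full where
  map_surjective {S T} g := by
    let f := @OrderedRadiant.toFun _ _ (assocInductive S.carrier).toOrderedConstellation
      (assocInductive T.carrier).toOrderedConstellation g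
    have hst : ∀ s : S.carrier, f (dstar s) = dstar (f s) :=
      @OrderedRadiant.map_st _ _ (assocInductive S.carrier).toOrderedConstellation
        (assocInductive T.carrier).toOrderedConstellation g
    -- The product s*t is a corestriction in the constellation, so a radiant preserves it.
    have hdm : ∀ s t : S.carrier, f (dstar s * t) = dstar (f s) * f t := fun s t => by
      have h1 := @OrderedRadiant.map_corestr _ _
        (assocInductive S.carrier).toOrderedConstellation
        (assocInductive T.carrier).toOrderedConstellation g t (dstar s) ⟨s, rfl⟩ _
        ((assoc_isCorestr_iff (dstar_dstar s)).2 rfl)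
      rw [← hst]
      refine (assoc_isCorestr_iff ?_).1 h1
      rw [hst, dstar_dstar]
    -- An arbitrary product is a defined one: st = s ∘ (s*t).
    have hmul : ∀ s t : S.carrier, f (s * t) = f s * f t := fun s t => by
      obtain ⟨_, h2⟩ := @OrderedRadiant.map_mul _ _
        (assocInductive S.carrier).toOrderedConstellation
        (assocInductive T.carrier).toOrderedConstellation g s (dstar s * t)
        (show dstar s * (dstar s * t) = dstar s * t by rw [← mul_assoc, dstar_idem])
      have h2' : f (s * (dstar s * t)) = f s * f (dstar s * t) := h2
      rwa [hdm, ← mul_assoc, ← mul_assoc, mul_dstar, mul_dstar] at h2'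
    exact ⟨⟨f, hmul, hst⟩, rfl⟩

instance : assocFunctor.{u}.IsEquivalence where

open ArrowCategory

/-! ### Restriction monoids and their characters -/

/-- Restriction semigroups with an identity. -/
class RestrictionMonoid (M : Type u) extends RestrictionSemigroup M, Monoid M

/-- Adjoining an identity to a restriction semigroup yields a restriction monoid. -/
instance (S : Type u) [RestrictionSemigroup S] : RestrictionMonoid (WithOne S) where
  dstar := WithOne.recOneCoe 1 fun s => ((dstar s : S) : WithOne S)
  mul_dstar x := by
    cases x with
    | one => exact one_mul 1
    | coe s => exact congrArg _ (mul_dstar s)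
  dstar_comm x y := by
    cases x with
    | one => exact (one_mul _).trans (mul_one _).symm
    | coe s => cases y with
      | one => exact (mul_one _).trans (one_mul _).symm
      | coe t => exact congrArg _ (dstar_comm s t)
  dstar_mul_dstar x y := by
    cases x with
    | one => cases y with
      | one => rfl
      | coe t => exact congrArg ((↑) : S → WithOne S) (dstar_dstar t)
    | coe s => cases y with
      | one => exact congrArg ((↑) : S → WithOne S) (dstar_dstar s)
      | coe t => exact congrArg ((↑) : S → WithOne S) (dstar_mul_dstar s t)
  dstar_mul x y := by
    cases x with
    | one => rfl
    | coe s => cases y with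
      | one => exact congrArg ((↑) : S → WithOne S) (dstar_dstar s).symm
      | coe t => exact congrArg ((↑) : S → WithOne S) (dstar_mul s t)
  dstar_mul_eq x y := by
    cases x with
    | one => cases y with
      | one => rfl
      | coe t => exact congrArg ((↑) : S → WithOne S) (mul_dstar t).symm
    | coe s => cases y with
      | one => exact (mul_one _).trans (one_mul _).symm
      | coe t => exact congrArg _ (RestrictionSemigroup.dstar_mul_eq s t)

variable {M : Type u} [RestrictionMonoid M]

variable (M) in
/-- The characters of the semilattice of projections of a restriction monoid, regarded as
functions on the whole monoid via `s ↦ s*`. -/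
def Character : Type u :=
  {χ : M → Bool // χ 1 = true ∧ ∀ x y, χ (x * dstar y) = (χ x && χ y)}

namespace Character

instance : FunLike (Character M) M Bool where
  coe := Subtype.val
  coe_injective := Subtype.val_injective

@[simp]
theorem map_one (χ : Character M) : χ 1 = true := χ.2.1

@[simp]
theorem map_mul_dstar (χ : Character M) (x y : M) : χ (x * dstar y) = (χ x && χ y) := χ.2.2 x y

@[simp]
theorem map_dstar (χ : Character M) (x : M) : χ (dstar x) = χ x := by
  rw [← one_mul (dstar x), map_mul_dstar, map_one, Bool.true_and]

theorem right_of_mul (χ : Character M) {x y : M} (h : χ (x * y) = true) : χ y = true := by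
  have : x * y = x * y * dstar y := by rw [mul_assoc, mul_dstar]
  rw [this, map_mul_dstar, Bool.and_eq_true] at h
  exact h.2

/-- The action of an element of the monoid on the characters in its domain. -/
def act (s : M) (χ : Character M) (h : χ s = true) : Character M :=
  ⟨fun a => χ (a * s), by simpa using h, fun x y => by
    beta_reduce
    -- The restriction identity moves s past the projection: (x y*) s = (x s)(y s)*.
    rw [mul_assoc, RestrictionSemigroup.dstar_mul_eq, ← mul_assoc, map_mul_dstar]⟩

@[simp]
theorem act_apply (s : M) (χ : Character M) (h : χ s = true) (a : M) :
    act s χ h a = χ (a * s) := rfl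

@[simp]
theorem act_one (χ : Character M) : act 1 χ χ.map_one = χ :=
  DFunLike.ext _ _ fun a => by simp

instance : TopologicalSpace (Character M) := inferInstanceAs (TopologicalSpace (Subtype _))

instance : T2Space (Character M) := inferInstanceAs (T2Space (Subtype _))

instance : TotallyDisconnectedSpace (Character M) :=
  inferInstanceAs (TotallyDisconnectedSpace (Subtype _))

theorem continuous_apply (s : M) : Continuous fun χ : Character M => χ s :=
  (_root_.continuous_apply s).comp continuous_subtype_val

/-- The characters form a closed subset of the Cantor-type product of copies of `Bool`. Because of
the identity, being nonzero is the closed condition χ(1) = 1. -/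
instance : CompactSpace (Character M) := by
  refine isCompact_iff_compactSpace.1 (IsClosed.isCompact ?_)
  have e (x : M) : Continuous fun χ : M → Bool => χ x := _root_.continuous_apply x
  have a : Continuous fun p : Bool × Bool => p.1 && p.2 := continuous_of_discreteTopology
  change IsClosed {χ : M → Bool | χ 1 = true ∧ ∀ x y, χ (x * dstar y) = (χ x && χ y)}
  simp only [Set.ofPred_and, Set.ofPred_forall]
  refine (isClosed_eq (e 1) continuous_const).inter
    (isClosed_iInter fun x => isClosed_iInter fun y => isClosed_eq (e _) ?_)
  exact a.comp ((e x).prodMk (e y))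

theorem isClopen_domain (s : M) : IsClopen {χ : Character M | χ s = true} :=
  (isClopen_discrete {true}).preimage (continuous_apply s)

open Classical in
/-- The principal character at `s*`. -/
noncomputable def principal (s : M) : Character M :=
  ⟨fun x => decide (dstar s = dstar x * dstar s), by
    have h1 : dstar (1 : M) = 1 := by
      conv_rhs => rw [← mul_dstar (1 : M), one_mul]
    simp [h1], fun x y => by
    rw [← Bool.decide_and, decide_eq_decide, dstar_mul_proj]
    constructor
    · intro h
      constructor
      · conv_rhs => rw [h, ← mul_assoc, ← mul_assoc, dstar_idem]
        exact h
      · conv_rhs => rw [h, ← mul_assoc, ← mul_assoc, dstar_comm y x, mul_assoc (dstar x),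
          dstar_idem]
        exact h
    · rintro ⟨h1, h2⟩
      rw [mul_assoc, ← h2, ← h1]⟩

theorem principal_apply_iff {s x : M} :
    principal s x = true ↔ dstar s = dstar x * dstar s := by
  classical exact decide_eq_true_iff

theorem principal_self (s : M) : principal s s = true :=
  principal_apply_iff.2 (dstar_idem s).symm

end Character

/-! ### The category of germs -/

variable (M) in
/-- The equivalence relation on pairs `(s, χ)`, with `χ` in the domain of `s`, whose classes are
the germs. -/
def germSetoid : Setoid {p : M × Character M // p.2 p.1 = true} where
  r p q := p.1.2 = q.1.2 ∧ ∃ e, p.1.2 e = true ∧ p.1.1 * dstar e = q.1.1 * dstar e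
  iseqv :=
    { refl := fun _ => ⟨rfl, 1, Character.map_one _, rfl⟩
      symm := by
        rintro p q ⟨h, e, he, h'⟩
        exact ⟨h.symm, e, h ▸ he, h'.symm⟩
      trans := by
        rintro p q r ⟨h, e, he, h'⟩ ⟨k, f, hf, k'⟩
        -- The star of this witness is e*f*, the meet of the two projections on which the
        -- representatives agree.
        refine ⟨h.trans k, e * dstar f, ?_, ?_⟩
        · rw [Character.map_mul_dstar, he, h, hf]
          rfl
        · rw [dstar_mul_proj, ← mul_assoc, h', mul_assoc, dstar_comm, ← mul_assoc, k', mul_assoc,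
            dstar_comm f e] }

variable (M) in
/-- Germs of the elements of a restriction monoid at the characters in their domains. -/
def Germ : Type u := Quotient (germSetoid M)

namespace Germ

/-- The germ of `s` at `χ`. -/
def mk (s : M) (χ : Character M) (h : χ s = true) : Germ M := Quotient.mk (germSetoid M) ⟨(s, χ), h⟩

theorem mk_eq_mk_iff {s t : M} {χ ψ : Character M} {h : χ s = true} {k : ψ t = true} :
    mk s χ h = mk t ψ k ↔ χ = ψ ∧ ∃ e, χ e = true ∧ s * dstar e = t * dstar e :=
  Quotient.eq (r := germSetoid M)

@[elab_as_elim]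
theorem ind {p : Germ M → Prop} (h : ∀ s χ hs, p (mk s χ hs)) (x : Germ M) : p x :=
  Quotient.ind (fun a => h a.1.1 a.1.2 a.2) x

/-- The character at which a germ is taken. -/
def source : Germ M → Character M := Quotient.lift (fun p => p.1.2) fun _ _ h => h.1

@[simp]
theorem source_mk (s : M) (χ : Character M) (h : χ s = true) : source (mk s χ h) = χ := rfl

/-- The image of the source of a germ. -/
def target : Germ M → Character M :=
  Quotient.lift (fun p => Character.act p.1.1 p.1.2 p.2) <| by
    rintro ⟨⟨s, χ⟩, hs⟩ ⟨⟨t, ψ⟩, ht⟩ ⟨h, e, he, h'⟩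
    obtain rfl : χ = ψ := h
    have he' : χ e = true := he
    refine DFunLike.ext _ _ fun a => ?_
    -- Multiplying by e* on the right does not change the value of χ, because χ(e) = 1.
    have h2 : χ (a * s * dstar e) = χ (a * t * dstar e) := by
      rw [mul_assoc, mul_assoc]
      exact congrArg (fun x => χ (a * x)) h'
    simpa [he'] using h2

@[simp]
theorem target_mk (s : M) (χ : Character M) (h : χ s = true) :
    target (mk s χ h) = Character.act s χ h := rfl

/-- The germ of the identity. -/
def unit (χ : Character M) : Germ M := mk 1 χ χ.map_one

@[simp]
theorem source_unit (χ : Character M) : source (unit χ) = χ := rfl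

@[simp]
theorem target_unit (χ : Character M) : target (unit χ) = χ := χ.act_one

theorem unit_injective : Function.Injective (unit : Character M → Germ M) :=
  Function.LeftInverse.injective source_unit

theorem exists_eq_mk_source (x : Germ M) : ∃ s h, x = mk s (source x) h :=
  ind (fun s _ h => ⟨s, h, rfl⟩) x

/-- A representative of a germ. -/
noncomputable def rep (x : Germ M) : M := (exists_eq_mk_source x).choose

theorem source_rep (x : Germ M) : source x (rep x) = true :=
  (exists_eq_mk_source x).choose_spec.choose

theorem mk_rep (x : Germ M) : mk (rep x) (source x) (source_rep x) = x :=
  (exists_eq_mk_source x).choose_spec.choose_spec.symm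

theorem source_rep_mul_rep {x y : Germ M} (h : target y = source x) :
    source y (rep x * rep y) = true := by
  have h1 := source_rep x
  rw [← h] at h1
  conv at h1 => lhs; rw [← mk_rep y]
  exact h1

/-- The composition of germs. -/
noncomputable def comp (x y : Germ M) (h : target y = source x) : Germ M :=
  mk (rep x * rep y) (source y) (source_rep_mul_rep h)

/-- Composition, defined through chosen representatives, does not depend on them. -/
theorem comp_mk {s t : M} {φ χ : Character M} (hs : φ s = true) (ht : χ t = true)
    (h : Character.act t χ ht = φ) :
    comp (mk s φ hs) (mk t χ ht) h = mk (s * t) χ (by rw [← h] at hs; exact hs) := by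
  obtain ⟨-, e, he, he'⟩ := mk_eq_mk_iff.1 (mk_rep (mk s φ hs))
  obtain ⟨-, f, hf, hf'⟩ := mk_eq_mk_iff.1 (mk_rep (mk t χ ht))
  set s' := rep (mk s φ hs)
  set t' := rep (mk t χ ht)
  have he1 : χ (e * t) = true := by
    rw [source_mk, ← h] at he
    exact he
  -- The chosen representatives agree with s on e* and with t on f*. The identity e*t = t(et)* pulls
  -- e* back through t, so the products agree on (et)*f*; and χ(et) = φ(e) = 1.
  refine mk_eq_mk_iff.2 ⟨rfl, e * t * dstar f, ?_, ?_⟩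
  · rw [source_mk] at hf ⊢
    simp [he1, hf]
  · change s' * t' * _ = _
    rw [dstar_mul_proj, dstar_comm]
    calc s' * t' * (dstar f * dstar (e * t)) = s' * (t' * dstar f) * dstar (e * t) := by
          simp only [mul_assoc]
      _ = s' * (t * dstar (e * t)) * dstar f := by
          rw [hf']
          simp only [mul_assoc]
          rw [dstar_comm]
      _ = s' * dstar e * t * dstar f := by
          rw [← RestrictionSemigroup.dstar_mul_eq]
          simp only [mul_assoc]
      _ = s * (dstar e * t) * dstar f := by
          rw [he']
          simp only [mul_assoc]
      _ = s * t * (dstar f * dstar (e * t)) := by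
          rw [RestrictionSemigroup.dstar_mul_eq, dstar_comm]
          simp only [mul_assoc]

theorem act_mul {s t : M} {φ χ : Character M} (hs : φ s = true) (ht : χ t = true)
    (h : Character.act t χ ht = φ) (hst : χ (s * t) = true) :
    Character.act (s * t) χ hst = Character.act s φ hs := by
  subst h
  refine DFunLike.ext _ _ fun a => ?_
  simp [mul_assoc]

theorem target_comp (x y : Germ M) (h : target y = source x) :
    target (comp x y h) = target x := by
  induction x using ind with | h s φ hs
  induction y using ind with | h t χ ht
  rw [comp_mk hs ht h]
  replace h : Character.act t χ ht = φ := h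
  have hst : χ (s * t) = true := by rwa [← h] at hs
  exact act_mul hs ht h hst

theorem comp_assoc (x y z : Germ M) (h : target y = source x) (k : target z = source y) :
    comp (comp x y h) z k = comp x (comp y z k) ((target_comp y z k).trans h) := by
  induction x using ind with | h s φ hs
  induction y using ind with | h t χ ht
  induction z using ind with | h r ψ hr
  have h1 : χ (s * t) = true := by
    have h' : Character.act t χ ht = φ := h
    rw [← h'] at hs
    exact hs
  have k1 : ψ (t * r) = true := by
    have k' : Character.act r ψ hr = χ := k
    rw [← k'] at ht
    exact ht
  have e1 : comp (mk s φ hs) (mk t χ ht) h = mk (s * t) χ h1 := comp_mk hs ht h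
  have e2 : comp (mk t χ ht) (mk r ψ hr) k = mk (t * r) ψ k1 := comp_mk ht hr k
  simp only [e1, e2]
  rw [comp_mk h1 hr k, comp_mk hs k1 ((act_mul ht hr k k1).trans h)]
  simp only [mul_assoc]

theorem unit_comp (x : Germ M) (h : target x = source (unit (target x))) :
    comp (unit (target x)) x h = x := by
  induction x using ind with | h s φ hs
  refine (comp_mk (Character.map_one _) hs h).trans ?_
  simp only [one_mul]

theorem comp_unit (x : Germ M) (h : target (unit (source x)) = source x) :
    comp x (unit (source x)) h = x := by
  induction x using ind with | h s φ hs
  refine (comp_mk hs (Character.map_one _) h).trans ?_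
  simp only [mul_one, source_mk]

theorem target_eq_iff {x y : Germ M} :
    unit (target y) = unit (source x) ↔ target y = source x := unit_injective.eq_iff

noncomputable instance : ArrowCategory (Germ M) where
  dom x := unit (source x)
  ran x := unit (target x)
  range_dom := by
    ext w
    constructor
    · rintro ⟨x, rfl⟩
      exact ⟨unit (source x), by simp⟩
    · rintro ⟨x, rfl⟩
      exact ⟨unit (target x), by simp⟩
  comp x y h := comp x y (target_eq_iff.1 h)
  dom_unit := by
    rintro _ ⟨x, rfl⟩
    simp
  ran_unit := by
    rintro _ ⟨x, rfl⟩
    simp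
  dom_comp x y h := rfl
  ran_comp x y h := by rw [target_comp]
  assoc x y z h k := comp_assoc x y z _ _
  ran_comp_self x h := unit_comp x _
  comp_dom_self x h := comp_unit x _

/-! ### The topology on germs -/

theorem exists_mk_inter (s : M) (O O' : Set (Germ M)) :
    {χ | ∃ h, mk s χ h ∈ O ∩ O'} = {χ | ∃ h, mk s χ h ∈ O} ∩ {χ | ∃ h, mk s χ h ∈ O'} := by
  ext χ
  exact ⟨fun ⟨h, h1, h2⟩ => ⟨⟨h, h1⟩, ⟨h, h2⟩⟩, fun ⟨⟨h, h1⟩, ⟨_, h2⟩⟩ => ⟨h, h1, h2⟩⟩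

/-- A set of germs is open if its trace on the germs of each element is. -/
instance : TopologicalSpace (Germ M) where
  IsOpen O := ∀ s : M, IsOpen {χ | ∃ h, mk s χ h ∈ O}
  isOpen_univ s := by simpa using (Character.isClopen_domain s).isOpen
  isOpen_inter O O' h h' s := by
    rw [exists_mk_inter]
    exact (h s).inter (h' s)
  isOpen_sUnion T hT s := by
    have : {χ | ∃ h, mk s χ h ∈ ⋃₀ T} = ⋃ O ∈ T, {χ | ∃ h, mk s χ h ∈ O} := by
      ext χ
      simp only [Set.mem_sUnion, Set.mem_ofPred_eq, Set.mem_iUnion]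
      tauto
    rw [this]
    exact isOpen_biUnion fun O hO => hT O hO s

theorem isOpen_iff {O : Set (Germ M)} : IsOpen O ↔ ∀ s : M, IsOpen {χ | ∃ h, mk s χ h ∈ O} :=
  Iff.rfl

theorem continuous_mk (s : M) :
    Continuous fun χ : {χ : Character M // χ s = true} => mk s χ.1 χ.2 := by
  refine continuous_def.2 fun O hO => ?_
  refine ⟨_, isOpen_iff.1 hO s, ?_⟩
  ext χ
  exact ⟨fun ⟨_, h⟩ => h, fun h => ⟨χ.2, h⟩⟩

theorem continuous_source : Continuous (source : Germ M → Character M) := by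
  refine continuous_def.2 fun V hV => isOpen_iff.2 fun s => ?_
  convert (Character.isClopen_domain s).isOpen.inter hV using 1
  ext χ
  simp

/-- On the germs of s, the coordinate of the target at a is χ(as), a continuous function of χ. -/
theorem continuous_target : Continuous (target : Germ M → Character M) := by
  refine continuous_induced_rng.2 (continuous_pi fun a => ?_)
  refine continuous_def.2 fun V _ => isOpen_iff.2 fun s => ?_
  convert (Character.isClopen_domain s).isOpen.inter
    ((isOpen_discrete V).preimage (Character.continuous_apply (a * s))) using 1
  ext χ
  change (∃ _ : χ s = true, χ (a * s) ∈ V) ↔ _ ∧ χ (a * s) ∈ V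
  exact exists_prop

theorem isOpenMap_source : IsOpenMap (source : Germ M → Character M) := fun O hO => by
  have : source '' O = ⋃ s : M, {χ | ∃ h, mk s χ h ∈ O} := by
    ext χ
    simp only [Set.mem_iUnion]
    constructor
    · rintro ⟨x, hx, rfl⟩
      exact ⟨rep x, source_rep x, by rwa [mk_rep]⟩
    · rintro ⟨s, h, hO⟩
      exact ⟨_, hO, rfl⟩
  rw [this]
  exact isOpen_iUnion fun s => isOpen_iff.1 hO s

theorem continuous_unit : Continuous (unit : Character M → Germ M) := by
  refine continuous_def.2 fun O hO => ?_
  convert isOpen_iff.1 hO 1 using 1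
  ext χ
  exact ⟨fun h => ⟨_, h⟩, fun ⟨_, h⟩ => h⟩

variable (M) in
/-- The units of the category of germs are the characters. -/
def unitsHomeomorph : Character M ≃ₜ units (Germ M) where
  toFun χ := ⟨unit χ, unit χ, rfl⟩
  invFun x := source x.1
  left_inv χ := rfl
  right_inv := by
    rintro ⟨_, x, rfl⟩
    rfl
  continuous_toFun := continuous_unit.subtype_mk _
  continuous_invFun := continuous_source.comp continuous_subtype_val

/-- The set of germs of `s` at the characters in `V`. -/
def slice (s : M) (V : Set (Character M)) : Set (Germ M) := {x | ∃ χ ∈ V, ∃ h, x = mk s χ h}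

/-- The germs of t and s agree at χ exactly when χ(e) = 1 for some e with te* = se*, so the trace on
the germs of t is V, cut down to the two domains and to a union of clopen sets. -/
theorem isOpen_slice (s : M) {V : Set (Character M)} (hV : IsOpen V) : IsOpen (slice s V) := by
  refine isOpen_iff.2 fun t => ?_
  have : {χ | ∃ h, mk t χ h ∈ slice s V} =
      V ∩ {χ | χ t = true} ∩ {χ | χ s = true} ∩
        ⋃ e ∈ {e : M | t * dstar e = s * dstar e}, {χ | χ e = true} := by
    ext χ
    simp only [slice, Set.mem_ofPred_eq, Set.mem_inter_iff, Set.mem_iUnion, mk_eq_mk_iff]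
    constructor
    · rintro ⟨h, ψ, hψ, hs, rfl, e, he, h'⟩
      exact ⟨⟨⟨hψ, h⟩, hs⟩, e, h', he⟩
    · rintro ⟨⟨⟨hψ, h⟩, hs⟩, e, h', he⟩
      exact ⟨h, χ, hψ, hs, rfl, e, he, h'⟩
  rw [this]
  exact ((hV.inter (Character.isClopen_domain t).isOpen).inter
    (Character.isClopen_domain s).isOpen).inter
      (isOpen_biUnion fun e _ => (Character.isClopen_domain e).isOpen)

theorem isOpenEmbedding_domU_slice (s : M) {V : Set (Character M)} (hV : IsOpen V) :
    Topology.IsOpenEmbedding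
      ((slice s V).domRestrict (domU : Germ M → units (Germ M))) := by
  refine (unitsHomeomorph M).isOpenEmbedding.comp (g := unitsHomeomorph M)
    (f := (slice s V).domRestrict source) (.of_continuous_injective_isOpenMap ?_ ?_ ?_)
  · exact continuous_source.comp continuous_subtype_val
  · rintro ⟨_, χ, hχ, h, rfl⟩ ⟨_, ψ, hψ, k, rfl⟩ e
    obtain rfl : χ = ψ := e
    rfl
  · exact isOpenMap_source.comp (isOpen_slice s hV).isOpenMap_subtype_val

theorem isSlice_slice (s : M) {V : Set (Character M)} (hV : IsOpen V) : IsSlice (slice s V) :=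
  ⟨isOpen_slice s hV, isOpenEmbedding_domU_slice s hV⟩

/-- The slice is the continuous image, under χ ↦ germ of s at χ, of a closed subset of the compact
domain of s. -/
theorem isCompact_slice (s : M) {V : Set (Character M)} (hV : IsClosed V) :
    IsCompact (slice s V) := by
  have : CompactSpace {χ : Character M // χ s = true} :=
    isCompact_iff_compactSpace.1 (Character.isClopen_domain s).isClosed.isCompact
  have h := ((hV.preimage continuous_subtype_val).isCompact).image (continuous_mk s)
  convert h using 1
  ext x
  constructor
  · rintro ⟨χ, hχ, h, rfl⟩
    exact ⟨⟨χ, h⟩, hχ, rfl⟩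
  · rintro ⟨⟨χ, h⟩, hχ, rfl⟩
    exact ⟨χ, hχ, h, rfl⟩

theorem slice_mem_compactSlices (s : M) {V : Set (Character M)} (hV : IsClopen V) :
    slice s V ∈ compactSlices (Germ M) :=
  ⟨isSlice_slice s hV.isOpen, isCompact_slice s hV.isClosed⟩

theorem mk_mem_slice_univ (s : M) (χ : Character M) (h : χ s = true) :
    mk s χ h ∈ slice s Set.univ := ⟨χ, trivial, h, rfl⟩

theorem comp_mem_slice_mul {s t : M} {V : Set (Character M)} {x y : Germ M}
    (hx : x ∈ slice s Set.univ) (hy : y ∈ slice t V) (h : target y = source x) :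
    comp x y h ∈ slice (s * t) V := by
  obtain ⟨φ, -, hs, rfl⟩ := hx
  obtain ⟨χ, hχ, ht, rfl⟩ := hy
  exact ⟨χ, hχ, _, comp_mk hs ht h⟩

theorem slice_mul_eq_setMul (s t : M) :
    slice (s * t) Set.univ = setMul (slice s Set.univ) (slice t Set.univ) := by
  ext z
  constructor
  · rintro ⟨χ, -, h, rfl⟩
    -- If χ(st) = 1 then χ(t) = 1, so the germ of st factors as the germ of s at tχ after the germ
    -- of t at χ.
    exact ⟨mk s (Character.act t χ (χ.right_of_mul h)) h, mk_mem_slice_univ _ _ _,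
      mk t χ (χ.right_of_mul h), mk_mem_slice_univ _ _ _, rfl, (comp_mk _ _ rfl).symm⟩
  · rintro ⟨x, hx, y, hy, h, rfl⟩
    exact comp_mem_slice_mul hx hy (target_eq_iff.1 h)

theorem slice_dstar_eq_setStar (s : M) :
    slice (dstar s) Set.univ = setStar (slice s Set.univ) := by
  have key (χ : Character M) (h : χ s = true) (k : χ (dstar s) = true) :
      mk (dstar s) χ k = unit χ :=
    mk_eq_mk_iff.2 ⟨rfl, s, h, by rw [dstar_idem, one_mul]⟩
  ext z
  constructor
  · rintro ⟨χ, -, h, rfl⟩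
    have h' : χ s = true := by rwa [Character.map_dstar] at h
    exact ⟨mk s χ h', mk_mem_slice_univ _ _ _, (key χ h' h).symm⟩
  · rintro ⟨_, ⟨χ, -, h, rfl⟩, rfl⟩
    exact ⟨χ, trivial, by rwa [Character.map_dstar], (key χ h _).symm⟩

/-- At the principal character of s*, the germ of s is a germ of t, so se* = te* for some e with s*
≤ e*. Multiplying by s* gives s = ts*. -/
theorem eq_mul_of_slice_subset {s t : M} (h : slice s Set.univ ⊆ slice t Set.univ) :
    s = t * dstar s := by
  obtain ⟨χ, -, ht, h'⟩ := h (mk_mem_slice_univ s _ (Character.principal_self s))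
  obtain ⟨-, e, he, h2⟩ := mk_eq_mk_iff.1 h'
  have he' := Character.principal_apply_iff.1 he
  calc s = s * dstar s := (mul_dstar s).symm
    _ = t * dstar s := by rw [he', ← mul_assoc, h2, mul_assoc]

theorem slice_injective : Function.Injective fun s : M => slice s Set.univ := fun s t h =>
  (natOrder M).le_antisymm s t (eq_mul_of_slice_subset (Eq.subset h))
    (eq_mul_of_slice_subset (Eq.subset h.symm))

theorem continuous_comp :
    Continuous fun p : pairs (Germ M) => ArrowCategory.comp p.1.1 p.1.2 p.2 := by
  refine continuous_def.2 fun O hO => isOpen_iff_forall_mem_open.2 ?_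
  rintro ⟨⟨x, y⟩, h⟩ hO'
  -- Germs of `rep x` composed with germs of `rep y` are germs of the product, so it suffices to
  -- keep the source in the trace of O on the germs of that product.
  set V := {χ | ∃ h, mk (rep x * rep y) χ h ∈ O}
  have hV : IsOpen V := isOpen_iff.1 hO _
  refine ⟨(fun p => p.1) ⁻¹' (slice (rep x) Set.univ ×ˢ slice (rep y) V), ?_,
    ((isOpen_slice _ isOpen_univ).prod (isOpen_slice _ hV)).preimage continuous_subtype_val,
    ⟨source x, trivial, source_rep x, (mk_rep x).symm⟩,
    ⟨source y, ⟨_, hO'⟩, source_rep y, (mk_rep y).symm⟩⟩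
  rintro ⟨⟨x', y'⟩, h'⟩ ⟨hx, hy⟩
  obtain ⟨χ, ⟨_, hχ⟩, _, e⟩ := comp_mem_slice_mul hx hy (target_eq_iff.1 h')
  change comp x' y' _ ∈ O
  rwa [e]

instance : IsAmple (Germ M) where
  continuous_dom := (unitsHomeomorph M).continuous.comp continuous_source
  continuous_ran := (unitsHomeomorph M).continuous.comp continuous_target
  continuous_comp := continuous_comp
  locallyCompact := (unitsHomeomorph M).symm.isOpenEmbedding.locallyCompactSpace
  hausdorff := (unitsHomeomorph M).t2Space
  isLocalHomeomorph_dom := isLocalHomeomorph_iff_isOpenEmbedding_restrict.2 fun x =>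
    ⟨slice (rep x) Set.univ, (isOpen_slice _ isOpen_univ).mem_nhds
      ⟨source x, trivial, source_rep x, (mk_rep x).symm⟩,
      isOpenEmbedding_domU_slice _ isOpen_univ⟩
  isBasis := by
    refine TopologicalSpace.isTopologicalBasis_of_isOpen_of_nhds (fun U hU => hU.1.1) ?_
    intro x O hx hO
    -- Clopen sets form a basis of the compact, Hausdorff, totally disconnected character space, and
    -- slices over clopen sets are compact.
    obtain ⟨V, hV, hxV, hVO⟩ := compact_exists_isClopen_in_isOpen (isOpen_iff.1 hO (rep x))
      (show source x ∈ _ from ⟨source_rep x, by rwa [mk_rep]⟩)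
    refine ⟨slice (rep x) V, slice_mem_compactSlices _ hV,
      ⟨source x, hxV, source_rep x, (mk_rep x).symm⟩, ?_⟩
    rintro _ ⟨χ, hχ, h, rfl⟩
    exact (hVO hχ).2

/-! ### The representation by compact slices -/

variable (S : Type u) [RestrictionSemigroup S] [Nonempty S]

/-- The compact slices of germs of the elements of a restriction semigroup. -/
def sliceSubsemigroup : SliceSubsemigroup (Germ (WithOne S)) where
  carrier := Set.range fun s : S => slice (s : WithOne S) Set.univ
  subset_compactSlices := by
    rintro _ ⟨s, rfl⟩
    exact slice_mem_compactSlices _ isClopen_univ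
  nonempty := Set.range_nonempty _
  mul_mem := by
    rintro _ ⟨s, rfl⟩ _ ⟨t, rfl⟩
    exact ⟨s * t, (congrArg (slice · Set.univ) (WithOne.coe_mul s t)).trans
      (slice_mul_eq_setMul _ _)⟩
  star_mem := by
    rintro _ ⟨s, rfl⟩
    exact ⟨dstar s, slice_dstar_eq_setStar (s : WithOne S)⟩

/-- The elements of a restriction semigroup correspond to their slices of germs. -/
noncomputable def sliceEquiv : S ≃ (sliceSubsemigroup S).carrier :=
  Equiv.ofInjective (fun s : S => slice (s : WithOne S) Set.univ)
    (slice_injective.comp WithOne.coe_injective)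

theorem sliceEquiv_mul (s t : S) : sliceEquiv S (s * t) = sliceEquiv S s * sliceEquiv S t :=
  Subtype.ext ((congrArg (slice · Set.univ) (WithOne.coe_mul s t)).trans
    (slice_mul_eq_setMul _ _))

theorem sliceEquiv_dstar (s : S) : sliceEquiv S (dstar s) = dstar (sliceEquiv S s) :=
  Subtype.ext (slice_dstar_eq_setStar (s : WithOne S))

end Germ

/-- Bijective morphisms of restriction semigroups are isomorphisms. -/
def RestrSgrp.isoOfEquiv {S T : RestrSgrp.{u}} (e : S.carrier ≃ T.carrier)
    (hmul : ∀ x y, e (x * y) = e x * e y) (hstar : ∀ x, e (dstar x) = dstar (e x)) : S ≅ T where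
  hom := (⟨e, hmul, hstar⟩ : RestrictionHom S.carrier T.carrier)
  inv := (⟨e.symm, fun x y => by simp [Equiv.symm_apply_eq, hmul],
    fun x => by simp [Equiv.symm_apply_eq, hstar]⟩ : RestrictionHom T.carrier S.carrier)
  hom_inv_id := RestrictionHom.ext (funext e.symm_apply_apply)
  inv_hom_id := RestrictionHom.ext (funext e.apply_symm_apply)

/-- Every restriction semigroup is isomorphic to a semigroup of compact slices. -/
noncomputable def RestrSgrp.isoSlices (S : RestrSgrp.{u}) :
    S ≅ (Germ.sliceSubsemigroup S.carrier).toRestrSgrp :=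
  RestrSgrp.isoOfEquiv (T := (Germ.sliceSubsemigroup S.carrier).toRestrSgrp)
    (Germ.sliceEquiv S.carrier) (Germ.sliceEquiv_mul S.carrier) (Germ.sliceEquiv_dstar S.carrier)

/-! ### The equivalences with constellations of compact slices. -/

instance : isSliceConstellation.{u}.ι.EssSurj where
  mem_essImage Q :=
    ⟨⟨assocFunctor.obj (Germ.sliceSubsemigroup Q.toRestrSgrp.carrier).toRestrSgrp,
      _, _, _, inferInstance, _, rfl⟩,
      ⟨(assocFunctor.mapIso Q.toRestrSgrp.isoSlices).symm ≪≫ assocFunctorObjIso Q⟩⟩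

instance : isSliceConstellation.{u}.ι.IsEquivalence where

end SliceESN

theorem mainTheorem8 :
    (SliceESN.isSliceConstellation.{u}.ι).IsEquivalence ∧
    ∃ E : SliceESN.RestrSgrp.{u} ≌ SliceESN.isSliceConstellation.{u}.FullSubcategory,
      Nonempty (E.functor ⋙ SliceESN.isSliceConstellation.{u}.ι ≅ SliceESN.assocFunctor.{u}) := by
  refine ⟨inferInstance, SliceESN.assocFunctor.asEquivalence.trans
    SliceESN.isSliceConstellation.ι.asEquivalence.symm, ⟨?_⟩⟩
  -- The equivalence is `assocFunctor` followed by a quasi-inverse of the inclusion; the counit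
  -- cancels that quasi-inverse against the inclusion.
  exact Functor.associator _ _ _ ≪≫
    Functor.isoWhiskerLeft _ SliceESN.isSliceConstellation.ι.asEquivalence.counitIso ≪≫
      Functor.rightUnitor _
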